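/- Let $F$ be a finite extension of $\mathbf{Q}_p$ with ring of integers $o_F$, let $\pi$ be a uniformizer of $o_F$, and let $k = o_F/\pi$, a finite field with $q$ elements. Let $\mathrm{LT}$ be the Lubin--Tate formal group attached to $\pi$, let $X$ be a coordinate on $\mathrm{LT}$, and for $a \in o_F$ let $[a](X) \in o_F[[X]]$ be the corresponding endomorphism; thus $[\pi](X) \equiv \pi X \bmod X^2$, $[\pi](X) \equiv X^q \bmod \pi$, and $[a](X)$ is the unique power series with $[a](X) \equiv aX \bmod X^2$ and $[\pi]([a](X)) = [a]([\pi](X))$. Let $\varphi(f)(X) = f([\pi](X))$ and let $\psi$ be the operator on $o_F[[X]]$ defined by $\varphi(\psi(f)) = \frac{1}{\pi} \operatorname{Tr}_{o_F[[X]]/\varphi(o_F[[X]])}(f)$; write $o_F[[X]]^{\psi=0}$ for the set of $f \in o_F[[X]]$ with $\psi(f)=0$. Let $\operatorname{Int}$ be the $o_F$-module of polynomials $P(T) \in F[T]$ such that $P(o_F) \subset o_F$. For $f \in o_F[[X]]$ and $n \geq 0$, let $c_{f,n}(T) \in \operatorname{Int}$ be the polynomial such that $f([a](X)) = \sum_{n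 \geq 0} c_{f,n}(a) X^n$ for all $a \in o_F$. For a subset $M$ of $o_F[[X]]$, let $\operatorname{Pol}(M)$ be the sub-$o_F$-module of $\operatorname{Int}$ generated by the $c_{f,n}$ with $f \in M$ and $n \geq 0$. Then the image of $\operatorname{Pol}(o_F[[X]]^{\psi=0})$ in $\operatorname{Int}/\pi\operatorname{Int}$ is an infinite-dimensional $k$-vector space. -/

import Mathlib

namespace LubinTate

theorem mem_integralClosure_iff_spectralNorm (p : ℕ) [Fact p.Prime] (F : Type*) [Field F] [Algebra ℚ_[p] F]
    [FiniteDimensional ℚ_[p] F] [Algebra ℤ_[p] F] [IsScalarTower ℤ_[p] ℚ_[p] F] (x : F) :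
   x ∈ integralClosure ℤ_[p] F ↔ spectralNorm ℚ_[p] F x ≤ 1 := by
  have hx : IsIntegral ℚ_[p] x := Algebra.IsIntegral.isIntegral x
  rw [mem_integralClosure_iff, spectralNorm, spectralValue_le_one_iff (minpoly.monic hx)]
  constructor
  · intro h n
    rw [minpoly.isIntegrallyClosed_eq_field_fractions' ℚ_[p] h, Polynomial.coeff_map]
    exact PadicInt.norm_le_one _
  · intro h
    have hl : minpoly ℚ_[p] x ∈ Polynomial.lifts (algebraMap ℤ_[p] ℚ_[p]) := by
      rw [Polynomial.lifts_iff_coeff_lifts]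
      intro n
      exact ⟨⟨_, h n⟩, rfl⟩
    obtain ⟨q, hq, -, hm⟩ := Polynomial.lifts_and_degree_eq_and_monic hl (minpoly.monic hx)
    refine ⟨q, hm, ?_⟩
    have h2 : Polynomial.aeval x (q.map (algebraMap ℤ_[p] ℚ_[p])) = 0 := by
      rw [hq]; exact minpoly.aeval _ _
    rw [Polynomial.aeval_map_algebraMap] at h2
    exact h2

theorem isLocalRing_integralClosure (p : ℕ) [Fact p.Prime] (F : Type*) [Field F] [Algebra ℚ_[p] F]
    [FiniteDimensional ℚ_[p] F] [Algebra ℤ_[p] F] [IsScalarTower ℤ_[p] ℚ_[p] F] : IsLocalRing (integralClosure ℤ_[p] F) := by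
  have hu : ∀ a : integralClosure ℤ_[p] F, spectralNorm ℚ_[p] F a = 1 → IsUnit a := by
    intro a ha
    have h0 : (a : F) ≠ 0 := by
      intro h; rw [h, spectralNorm_zero] at ha; exact zero_ne_one ha
    have h1 : spectralNorm ℚ_[p] F (a : F)⁻¹ = 1 := by
      have := map_mul (spectralMulAlgNorm ℚ_[p] F) (a : F) (a : F)⁻¹
      rw [mul_inv_cancel₀ h0, map_one, spectralMulAlgNorm_def, spectralMulAlgNorm_def, ha, one_mul] at this
      exact this.symm
    exact IsUnit.of_mul_eq_one ⟨(a : F)⁻¹, (mem_integralClosure_iff_spectralNorm p F _).2 h1.le⟩ (Subtype.ext (mul_inv_cancel₀ h0))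
  have hn : ∀ a : integralClosure ℤ_[p] F, IsUnit a → spectralNorm ℚ_[p] F a = 1 := by
    rintro a ⟨u, rfl⟩
    have h1 := (mem_integralClosure_iff_spectralNorm p F _).1 (u : integralClosure ℤ_[p] F).2
    have h2 := (mem_integralClosure_iff_spectralNorm p F _).1 ((u⁻¹ : (integralClosure ℤ_[p] F)ˣ) : integralClosure ℤ_[p] F).2
    have := map_mul (spectralMulAlgNorm ℚ_[p] F) ((u : integralClosure ℤ_[p] F) : F) (((u⁻¹ : (integralClosure ℤ_[p] F)ˣ) : integralClosure ℤ_[p] F) : F)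
    rw [← Subalgebra.coe_mul, Units.mul_inv, Subalgebra.coe_one, map_one, spectralMulAlgNorm_def, spectralMulAlgNorm_def] at this
    refine le_antisymm h1 ?_
    rw [this]
    exact mul_le_of_le_one_right (spectralNorm_nonneg _) h2
  refine IsLocalRing.of_nonunits_add fun a b ha hb => ?_
  have ha' := lt_of_le_of_ne ((mem_integralClosure_iff_spectralNorm p F _).1 a.2) (fun h => ha (hu a h))
  have hb' := lt_of_le_of_ne ((mem_integralClosure_iff_spectralNorm p F _).1 b.2) (fun h => hb (hu b h))
  intro h
  have := hn _ h
  have h3 := isNonarchimedean_spectralNorm (K := ℚ_[p]) (L := F) (a : F) b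
  rw [Subalgebra.coe_add] at this
  rw [this] at h3
  exact absurd h3 (not_le.2 (max_lt ha' hb'))

theorem algebraMap_injective (p : ℕ) [Fact p.Prime] (F : Type*) [Field F] [Algebra ℚ_[p] F]
    [Algebra ℤ_[p] F] [IsScalarTower ℤ_[p] ℚ_[p] F] :
    Function.Injective (algebraMap ℤ_[p] (integralClosure ℤ_[p] F)) := by
  have : Function.Injective (algebraMap ℤ_[p] F) := by
    rw [IsScalarTower.algebraMap_eq ℤ_[p] ℚ_[p] F]
    exact (algebraMap ℚ_[p] F).injective.comp (IsFractionRing.injective ℤ_[p] ℚ_[p])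
  rw [IsScalarTower.algebraMap_eq ℤ_[p] (integralClosure ℤ_[p] F) F, RingHom.coe_comp] at this
  exact Function.Injective.of_comp this

instance isDiscreteValuationRing_integralClosure (p : ℕ) [Fact p.Prime] (F : Type*) [Field F] [Algebra ℚ_[p] F]
    [FiniteDimensional ℚ_[p] F] [Algebra ℤ_[p] F] [IsScalarTower ℤ_[p] ℚ_[p] F] :
    IsDiscreteValuationRing (integralClosure ℤ_[p] F) := by
  have : IsLocalRing (integralClosure ℤ_[p] F) := isLocalRing_integralClosure p F
  have : IsDedekindDomain (integralClosure ℤ_[p] F) := integralClosure.isDedekindDomain ℤ_[p] ℚ_[p] F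
  have hf : ¬ IsField (integralClosure ℤ_[p] F) := by
    intro h
    exact IsDiscreteValuationRing.not_isField ℤ_[p] (isField_of_isIntegral_of_isField (algebraMap_injective p F) h)
  exact ((IsDiscreteValuationRing.TFAE (integralClosure ℤ_[p] F) hf).out 0 2).2 this

instance finite_residueField_integralClosure (p : ℕ) [Fact p.Prime] (F : Type*) [Field F] [Algebra ℚ_[p] F]
    [FiniteDimensional ℚ_[p] F] [Algebra ℤ_[p] F] [IsScalarTower ℤ_[p] ℚ_[p] F] :
    Finite (IsLocalRing.ResidueField (integralClosure ℤ_[p] F)) := by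
  have : Module.Finite ℤ_[p] (integralClosure ℤ_[p] F) := IsIntegralClosure.finite ℤ_[p] ℚ_[p] F _
  have : FaithfulSMul ℤ_[p] (integralClosure ℤ_[p] F) :=
    (faithfulSMul_iff_algebraMap_injective _ _).2 (algebraMap_injective p F)
  have : Finite (IsLocalRing.ResidueField ℤ_[p]) :=
    Finite.of_equiv _ (PadicInt.residueField (p := p)).symm.toEquiv
  exact Module.finite_of_finite (IsLocalRing.ResidueField ℤ_[p])

section General

variable {O : Type*} [CommRing O]

/-- A Lubin-Tate series for `π`: a power series `φ(X) ∈ O⟦X⟧` with `φ(X) ≡ π X` modulo degree `2`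
and `φ(X) ≡ X ^ q` modulo `π`, where `q` is the cardinality of `O / π`.
Such a `φ` is the series `[π](X)` of the Lubin-Tate formal group attached to `π`, written in a
coordinate `X`. The series `[π](X)` of every coordinate of the Lubin-Tate group has these two
properties, and every `φ` with these properties comes from a coordinate. -/
structure LubinTateSeries (π : O) where
  toPowerSeries : PowerSeries O
  constantCoeff_eq_zero : PowerSeries.constantCoeff toPowerSeries = 0
  coeff_one_eq : PowerSeries.coeff 1 toPowerSeries = π
  map_mk_eq : PowerSeries.map (Ideal.Quotient.mk (Ideal.span {π})) toPowerSeries =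
    PowerSeries.X ^ Nat.card (O ⧸ Ideal.span {π})

theorem LubinTateSeries.hasSubst {π : O} (φ : LubinTateSeries π) :
    PowerSeries.HasSubst φ.toPowerSeries :=
  PowerSeries.HasSubst.of_constantCoeff_zero' φ.constantCoeff_eq_zero

theorem coeff_subst_sub {b c f : PowerSeries O} (hb : PowerSeries.constantCoeff b = 0)
    (hc : PowerSeries.constantCoeff c = 0) {m : ℕ} (h : PowerSeries.X ^ m ∣ b - c) :
    PowerSeries.coeff m (f.subst b) - PowerSeries.coeff m (f.subst c) =
      PowerSeries.coeff 1 f * (PowerSeries.coeff m b - PowerSeries.coeff m c) := by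
  have hb' := PowerSeries.HasSubst.of_constantCoeff_zero' hb
  have hc' := PowerSeries.HasSubst.of_constantCoeff_zero' hc
  rw [PowerSeries.coeff_subst' hb', PowerSeries.coeff_subst' hc',
    ← finsum_sub_distrib (PowerSeries.coeff_subst_finite' hb' f m)
      (PowerSeries.coeff_subst_finite' hc' f m), finsum_eq_single _ 1]
  · simp [mul_sub]
  · intro d hd
    rw [← smul_sub, ← map_sub]
    rcases Nat.lt_or_gt_of_ne hd with hd | hd
    · obtain rfl : d = 0 := by omega
      simp
    · have hXb : PowerSeries.X ∣ b := PowerSeries.X_dvd_iff.2 hb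
      have hXc : PowerSeries.X ∣ c := PowerSeries.X_dvd_iff.2 hc
      have key : PowerSeries.X ^ (m + 1) ∣ b ^ d - c ^ d := by
        rw [← (Commute.all b c).geom_sum₂_mul d, pow_succ']
        refine mul_dvd_mul (Finset.dvd_sum fun i hi => ?_) h
        by_cases hi0 : i = 0
        · exact Dvd.dvd.mul_left (dvd_pow hXc (by omega)) _
        · exact Dvd.dvd.mul_right (dvd_pow hXb hi0) _
      rw [PowerSeries.X_pow_dvd_iff.1 key m (by omega), smul_zero]

theorem coeff_subst_of_dvd {π : O} (φ : LubinTateSeries π) {h : PowerSeries O} {m : ℕ}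
    (hh : PowerSeries.X ^ m ∣ h) :
    PowerSeries.coeff m (h.subst φ.toPowerSeries) = π ^ m * PowerSeries.coeff m h := by
  obtain ⟨ψ, hψ⟩ := PowerSeries.X_dvd_iff.2 φ.constantCoeff_eq_zero
  have hψ0 : PowerSeries.constantCoeff ψ = π := by
    have := φ.coeff_one_eq
    rwa [hψ, ← zero_add 1, PowerSeries.coeff_succ_X_mul,
      PowerSeries.coeff_zero_eq_constantCoeff_apply] at this
  rw [PowerSeries.coeff_subst' φ.hasSubst, finsum_eq_single _ m]
  · rw [hψ, mul_pow, PowerSeries.coeff_X_pow_mul']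
    simp [hψ0, mul_comm]
  · intro d hd
    rcases Nat.lt_or_gt_of_ne hd with hd | hd
    · rw [PowerSeries.X_pow_dvd_iff.1 hh d hd, zero_smul]
    · rw [hψ, mul_pow, PowerSeries.coeff_X_pow_mul', if_neg (by omega), smul_zero]

theorem expand_card {k : Type*} [Field k] [Finite k] (hq : Nat.card k ≠ 0) (f : PowerSeries k) :
    f.subst (PowerSeries.X ^ Nat.card k : PowerSeries k) = f ^ Nat.card k := by
  have := Fintype.ofFinite k
  obtain ⟨p, hchar⟩ := CharP.exists k
  have : CharP k p := hchar
  obtain ⟨n, hp, hn⟩ := FiniteField.card k p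
  have : Fact p.Prime := ⟨hp⟩
  have hcard : Nat.card k = p ^ (n : ℕ) := by rw [Nat.card_eq_fintype_card, hn]
  have h1 := MvPowerSeries.map_iterateFrobenius_expand (p := p) hp.ne_zero (f : MvPowerSeries Unit k) n
  have h2 : iterateFrobenius k p n = RingHom.id k := by
    ext x
    rw [iterateFrobenius_def, ← hn, FiniteField.pow_card, RingHom.id_apply]
  rw [h2, MvPowerSeries.map_id, RingHom.id_apply] at h1
  rw [← PowerSeries.expand_apply _ hq]
  simp only [hcard]
  exact h1

theorem dvd_coeff {π : O} [(Ideal.span {π}).IsMaximal] [Finite (O ⧸ Ideal.span {π})]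
    (φ : LubinTateSeries π) {g : PowerSeries O} (hg : PowerSeries.constantCoeff g = 0) (m : ℕ) :
    π ∣ PowerSeries.coeff m (φ.toPowerSeries.subst g - g.subst φ.toPowerSeries) := by
  let _ : Field (O ⧸ Ideal.span {π}) := Ideal.Quotient.field _
  have hq : Nat.card (O ⧸ Ideal.span {π}) ≠ 0 := Nat.card_pos.ne'
  rw [← Ideal.mem_span_singleton, ← Ideal.Quotient.eq_zero_iff_mem, ← PowerSeries.coeff_map,
    map_sub]
  have hg' := PowerSeries.HasSubst.of_constantCoeff_zero' hg
  have e1 := PowerSeries.map_subst hg' (h := Ideal.Quotient.mk (Ideal.span {π})) φ.toPowerSeries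
  have e2 := PowerSeries.map_subst φ.hasSubst (h := Ideal.Quotient.mk (Ideal.span {π})) g
  have hg'' : PowerSeries.HasSubst (PowerSeries.map (Ideal.Quotient.mk (Ideal.span {π})) g) :=
    PowerSeries.HasSubst.of_constantCoeff_zero' (by
      rw [← PowerSeries.coeff_zero_eq_constantCoeff_apply, PowerSeries.coeff_map,
        PowerSeries.coeff_zero_eq_constantCoeff_apply, hg, map_zero])
  have e3 : PowerSeries.map (Ideal.Quotient.mk (Ideal.span {π})) (φ.toPowerSeries.subst g) =
      PowerSeries.map (Ideal.Quotient.mk (Ideal.span {π})) g ^ Nat.card (O ⧸ Ideal.span {π}) := by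
    refine e1.trans ?_
    rw [φ.map_mk_eq]
    exact (PowerSeries.subst_pow hg'' _ _).trans (congrArg (· ^ _) (PowerSeries.subst_X hg''))
  have e4 : PowerSeries.map (Ideal.Quotient.mk (Ideal.span {π})) (g.subst φ.toPowerSeries) =
      PowerSeries.map (Ideal.Quotient.mk (Ideal.span {π})) g ^ Nat.card (O ⧸ Ideal.span {π}) := by
    refine e2.trans ?_
    rw [← expand_card hq]
    congr 1
    exact φ.map_mk_eq
  rw [e3, e4, sub_self, map_zero]

theorem coeff_defect_sub {π : O} (φ : LubinTateSeries π) {g g' : PowerSeries O}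
    (hg : PowerSeries.constantCoeff g = 0) (hg' : PowerSeries.constantCoeff g' = 0) {m : ℕ}
    (h : PowerSeries.X ^ m ∣ g' - g) :
    PowerSeries.coeff m (φ.toPowerSeries.subst g' - g'.subst φ.toPowerSeries) -
      PowerSeries.coeff m (φ.toPowerSeries.subst g - g.subst φ.toPowerSeries) =
      (π - π ^ m) * (PowerSeries.coeff m g' - PowerSeries.coeff m g) := by
  have h1 := coeff_subst_sub (f := φ.toPowerSeries) hg' hg h
  have h2 := coeff_subst_of_dvd φ h
  have h3 : (g' - g).subst φ.toPowerSeries =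
      g'.subst φ.toPowerSeries - g.subst φ.toPowerSeries := PowerSeries.subst_sub φ.hasSubst _ _
  rw [h3, map_sub, map_sub] at h2
  rw [φ.coeff_one_eq] at h1
  rw [map_sub, map_sub]
  linear_combination h1 - h2

theorem coeff_zero_defect {π : O} (φ : LubinTateSeries π) {g : PowerSeries O}
    (hg : PowerSeries.constantCoeff g = 0) :
    PowerSeries.coeff 0 (φ.toPowerSeries.subst g - g.subst φ.toPowerSeries) = 0 := by
  have h1 := PowerSeries.constantCoeff_subst_eq_zero hg φ.toPowerSeries φ.constantCoeff_eq_zero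
  have h2 := PowerSeries.constantCoeff_subst_eq_zero φ.constantCoeff_eq_zero g hg
  rw [map_sub, PowerSeries.coeff_zero_eq_constantCoeff_apply,
    PowerSeries.coeff_zero_eq_constantCoeff_apply]
  exact (congrArg₂ (· - ·) h1 h2).trans (sub_zero _)

end General

section DVR

variable {O : Type*} [CommRing O] [IsDomain O] [IsDiscreteValuationRing O]
  [Finite (IsLocalRing.ResidueField O)]

theorem existsUnique_mulSeries {π : O} (hπ : Irreducible π) (φ : LubinTateSeries π) (a : O) :
    ∃! g : PowerSeries O, PowerSeries.constantCoeff g = 0 ∧ PowerSeries.coeff 1 g = a ∧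
      φ.toPowerSeries.subst g = g.subst φ.toPowerSeries := by
  have hmax : IsLocalRing.maximalIdeal O = Ideal.span {π} := hπ.maximalIdeal_eq
  have : (Ideal.span {π}).IsMaximal := hmax ▸ IsLocalRing.maximalIdeal.isMaximal O
  have : Finite (O ⧸ Ideal.span {π}) := by
    rw [← hmax]; exact ‹Finite (IsLocalRing.ResidueField O)›
  have hunit : ∀ m, 2 ≤ m → ∃ u : Oˣ, π - π ^ m = π * u := by
    intro m hm
    have : IsUnit (1 - π ^ (m - 1)) := by
      apply IsLocalRing.isUnit_one_sub_self_of_mem_nonunits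
      rw [mem_nonunits_iff, isUnit_pow_iff (by omega)]
      exact hπ.not_isUnit
    refine ⟨this.unit, ?_⟩
    rw [IsUnit.unit_spec, mul_sub, mul_one, ← pow_succ', Nat.sub_add_cancel (by omega)]
  have huniq : ∀ (n : ℕ) (g g' : PowerSeries O), PowerSeries.constantCoeff g = 0 →
      PowerSeries.constantCoeff g' = 0 → PowerSeries.coeff 1 g = PowerSeries.coeff 1 g' →
      (∀ m ≤ n, PowerSeries.coeff m (φ.toPowerSeries.subst g - g.subst φ.toPowerSeries) = 0) →
      (∀ m ≤ n, PowerSeries.coeff m (φ.toPowerSeries.subst g' - g'.subst φ.toPowerSeries) = 0) →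
      ∀ m ≤ n, PowerSeries.coeff m g' = PowerSeries.coeff m g := by
    intro n g g' h0 h0' h1 hE hE' m
    induction m using Nat.strong_induction_on with
    | _ m ih =>
      intro hm
      rcases Nat.lt_or_ge m 2 with hm2 | hm2
      · interval_cases m
        · simp [h0, h0']
        · exact h1.symm
      · have hX : PowerSeries.X ^ m ∣ g' - g := by
          rw [PowerSeries.X_pow_dvd_iff]
          intro i hi
          rw [map_sub, ih i hi (by omega), sub_self]
        have := coeff_defect_sub φ h0 h0' hX
        obtain ⟨u, hu⟩ := hunit m hm2
        rw [hE m hm, hE' m hm, sub_self, hu] at this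
        have h2 : π * (u : O) ≠ 0 := mul_ne_zero hπ.ne_zero u.ne_zero
        exact sub_eq_zero.1 ((mul_eq_zero.1 this.symm).resolve_left h2)
  have hex : ∀ n : ℕ, ∃ g : PowerSeries O, PowerSeries.constantCoeff g = 0 ∧
      PowerSeries.coeff 1 g = a ∧ ∀ m ≤ n + 1,
        PowerSeries.coeff m (φ.toPowerSeries.subst g - g.subst φ.toPowerSeries) = 0 := by
    intro n
    induction n with
    | zero =>
      have hg : PowerSeries.constantCoeff (PowerSeries.C a * PowerSeries.X) = 0 := by simp
      refine ⟨PowerSeries.C a * PowerSeries.X, hg, by simp, fun m hm => ?_⟩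
      rcases Nat.le_one_iff_eq_zero_or_eq_one.1 hm with rfl | rfl
      · exact coeff_zero_defect φ hg
      · have h1 := coeff_subst_sub (f := φ.toPowerSeries) hg (map_zero _) (m := 1) (by simp)
        have h2 := coeff_subst_of_dvd φ (h := PowerSeries.C a * PowerSeries.X) (m := 1) (by simp)
        have h3 : PowerSeries.coeff 1 (φ.toPowerSeries.subst (0 : PowerSeries O)) = 0 := by
          rw [PowerSeries.subst_zero_of_constantCoeff_zero φ.constantCoeff_eq_zero]
          exact map_zero _
        rw [h3, sub_zero, map_zero, sub_zero, φ.coeff_one_eq] at h1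
        rw [map_sub, h1, h2, pow_one, sub_self]
    | succ n ih =>
      obtain ⟨g, h0, h1, hE⟩ := ih
      obtain ⟨d, hd⟩ := dvd_coeff φ h0 (n + 1 + 1)
      obtain ⟨u, hu⟩ := hunit (n + 1 + 1) (by omega)
      set c : O := -(↑u⁻¹ * d) with hc
      set g' : PowerSeries O := g + PowerSeries.C c * PowerSeries.X ^ (n + 1 + 1) with hg'
      have hX : PowerSeries.X ^ (n + 1 + 1) ∣ g' - g := by
        rw [hg', add_sub_cancel_left]; exact dvd_mul_left _ _
      have h0' : PowerSeries.constantCoeff g' = 0 := by simp [hg', h0]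
      refine ⟨g', h0', ?_, fun m hm => ?_⟩
      · simp [hg', h1, PowerSeries.coeff_X_pow]
      · rcases Nat.eq_zero_or_pos m with rfl | hm0
        · exact coeff_zero_defect φ h0'
        · have hd' := coeff_defect_sub φ h0 h0' ((pow_dvd_pow _ hm).trans hX)
          rcases Nat.lt_or_ge m (n + 1 + 1) with hlt | hge
          · rw [hE m (by omega), sub_zero] at hd'
            rw [hd', ← map_sub, PowerSeries.X_pow_dvd_iff.1 hX m hlt, mul_zero]
          · obtain rfl : m = n + 1 + 1 := by omega
            have hcoef : PowerSeries.coeff (n + 1 + 1) g' - PowerSeries.coeff (n + 1 + 1) g = c := by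
              rw [← map_sub, hg', add_sub_cancel_left]; simp
            rw [hd, hu, hcoef] at hd'
            have : (u : O) * ↑u⁻¹ = 1 := u.mul_inv
            rw [hc] at hd'
            linear_combination hd' - π * d * this
  choose G hG0 hG1 hGE using hex
  set g : PowerSeries O := PowerSeries.mk fun m => PowerSeries.coeff m (G m) with hg
  have hagree : ∀ n, ∀ m ≤ n + 1, PowerSeries.coeff m g = PowerSeries.coeff m (G n) := by
    intro n m hm
    rw [hg, PowerSeries.coeff_mk]
    rcases Nat.le_total m n with h | h
    · exact (huniq (m + 1) (G m) (G n) (hG0 m) (hG0 n) ((hG1 m).trans (hG1 n).symm) (hGE m)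
        (fun i hi => hGE n i (by omega)) m (by omega)).symm
    · exact (huniq (n + 1) (G n) (G m) (hG0 n) (hG0 m) ((hG1 n).trans (hG1 m).symm) (hGE n)
        (fun i hi => hGE m i (by omega)) m (by omega))
  have hg0 : PowerSeries.constantCoeff g = 0 := by
    have := hagree 0 0 (by omega)
    simpa [hG0] using this
  refine ⟨g, ⟨hg0, (hagree 0 1 le_rfl).trans (hG1 0), ?_⟩, ?_⟩
  · rw [← sub_eq_zero]
    ext m
    rw [map_zero]
    rcases Nat.eq_zero_or_pos m with rfl | hm0
    · exact coeff_zero_defect φ hg0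
    · have hX : PowerSeries.X ^ m ∣ g - G m := by
        rw [PowerSeries.X_pow_dvd_iff]
        intro i hi
        rw [map_sub, hagree m i (by omega), sub_self]
      have := coeff_defect_sub φ (hG0 m) hg0 hX
      rwa [hGE m m (by omega), hagree m m (by omega), sub_self, mul_zero, sub_zero] at this
  · rintro g' ⟨h0', h1', hE'⟩
    ext m
    refine huniq m g g' hg0 h0' ?_ ?_ ?_ m le_rfl
    · rw [h1', hagree 0 1 le_rfl, hG1]
    · intro i _
      rcases Nat.eq_zero_or_pos i with rfl | hi0
      · exact coeff_zero_defect φ hg0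
      · have hX : PowerSeries.X ^ i ∣ g - G i := by
          rw [PowerSeries.X_pow_dvd_iff]
          intro j hj
          rw [map_sub, hagree i j (by omega), sub_self]
        have := coeff_defect_sub φ (hG0 i) hg0 hX
        rwa [hGE i i (by omega), hagree i i (by omega), sub_self, mul_zero, sub_zero] at this
    · intro i _
      rw [hE', sub_self, map_zero]

/-- The multiplication series `[a](X)`, for `a ∈ O`, of the Lubin-Tate formal group whose series
`[π](X)` is `φ`: the unique power series with `[a](X) ≡ a X` modulo degree `2` that commutes with
`φ` under composition. -/
noncomputable def mulSeries {π : O} (hπ : Irreducible π) (φ : LubinTateSeries π) (a : O) :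
    PowerSeries O :=
  (existsUnique_mulSeries hπ φ a).choose

theorem mulSeries_spec {π : O} (hπ : Irreducible π) (φ : LubinTateSeries π) (a : O) :
    PowerSeries.constantCoeff (mulSeries hπ φ a) = 0 ∧
      PowerSeries.coeff 1 (mulSeries hπ φ a) = a ∧
      φ.toPowerSeries.subst (mulSeries hπ φ a) = (mulSeries hπ φ a).subst φ.toPowerSeries :=
  (existsUnique_mulSeries hπ φ a).choose_spec.1

end DVR

section Operators

variable {O : Type*} [CommRing O]

/-- The operator `f(X) ↦ f([π](X))` on `O⟦X⟧`. -/
noncomputable def phi {π : O} (φ : LubinTateSeries π) : PowerSeries O →ₐ[O] PowerSeries O :=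
  PowerSeries.substAlgHom φ.hasSubst

/-- The trace of `f ∈ O⟦X⟧` for the extension `O⟦X⟧ / phi (O⟦X⟧)`, seen in `O⟦X⟧`. -/
noncomputable def tracePhi {π : O} (φ : LubinTateSeries π) (f : PowerSeries O) : PowerSeries O :=
  (Algebra.trace (phi φ).range (PowerSeries O) f : (phi φ).range)

/-- The relation `ψ(f) = g`, where `ψ` is the operator on `O⟦X⟧` given by
`phi (ψ f) = (1 / π) Tr f`. -/
def IsPsi {π : O} (φ : LubinTateSeries π) (f g : PowerSeries O) : Prop :=
  PowerSeries.C π * phi φ g = tracePhi φ f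

/-- The set `O⟦X⟧^{ψ = 0}`. -/
def psiKernel {π : O} (φ : LubinTateSeries π) : Set (PowerSeries O) :=
  {f | IsPsi φ f 0}

end Operators

section IntegerValued

variable (O : Type*) [CommRing O] (F : Type*) [Field F] [Algebra O F]

/-- The `O`-module `Int` of the polynomials `P(T) ∈ F[T]` with `P(O) ⊆ O`. -/
def integerValued : Submodule O (Polynomial F) where
  carrier := {P | ∀ a : O, P.eval (algebraMap O F a) ∈ (algebraMap O F).range}
  add_mem' := by
    intro P Q hP hQ a
    rw [Polynomial.eval_add]
    exact add_mem (hP a) (hQ a)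
  zero_mem' := by
    intro a
    rw [Polynomial.eval_zero]
    exact zero_mem _
  smul_mem' := by
    intro c P hP a
    rw [Polynomial.eval_smul, Algebra.smul_def]
    exact mul_mem ⟨c, rfl⟩ (hP a)

variable {O}

/-- The quotient `Int / π Int`. -/
abbrev IntModPi (π : O) : Type _ :=
  integerValued O F ⧸ (Ideal.span {π} • (⊤ : Submodule O (integerValued O F)))

/-- The image in `Int / π Int` of a sub-`O`-module of `Int`, as a module over `O / π`. -/
def imageModPi (π : O) (N : Submodule O (integerValued O F)) :
    Submodule (O ⧸ Ideal.span {π}) (IntModPi F π) where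
  carrier := (Submodule.mkQ _ : integerValued O F →ₗ[O] IntModPi F π) '' N
  add_mem' := by
    rintro _ _ ⟨P, hP, rfl⟩ ⟨Q, hQ, rfl⟩
    exact ⟨P + Q, N.add_mem hP hQ, map_add _ _ _⟩
  zero_mem' := ⟨0, N.zero_mem, map_zero _⟩
  smul_mem' := by
    intro c x hx
    obtain ⟨c, rfl⟩ := Ideal.Quotient.mk_surjective c
    obtain ⟨P, hP, rfl⟩ := hx
    exact ⟨c • P, N.smul_mem c hP, rfl⟩

variable [IsDomain O] [IsDiscreteValuationRing O] [Finite (IsLocalRing.ResidueField O)]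

/-- `P` is the polynomial `c_{f,n}(T)`: for all `a ∈ O`, the coefficient of `X ^ n` in `f([a](X))`
is `P(a)`. As `O` is infinite, there is at most one such `P`. -/
def IsCoeffPolynomial {π : O} (hπ : Irreducible π) (φ : LubinTateSeries π) (f : PowerSeries O)
    (n : ℕ) (P : Polynomial F) : Prop :=
  ∀ a : O, P.eval (algebraMap O F a) =
    algebraMap O F (PowerSeries.coeff n (f.subst (mulSeries hπ φ a)))

/-- The sub-`O`-module `Pol(M)` of `Int` generated by the `c_{f,n}` with `f ∈ M` and `n ≥ 0`. -/
noncomputable def Pol {π : O} (hπ : Irreducible π) (φ : LubinTateSeries π) (M : Set (PowerSeries O)) :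
    Submodule O (integerValued O F) :=
  Submodule.span O {P | ∃ f ∈ M, ∃ n : ℕ, IsCoeffPolynomial F hπ φ f n (P : Polynomial F)}

end IntegerValued

end LubinTate

/-! Everything takes place modulo `π`, where `[π^m](X)` becomes `X^(q^m)`. Let `g` be killed by `ψ`,
with nonzero reduction `gbar` of order `d > 0` in `X`. For `P_M = c_{g, d q^M}`, the value
`P_M(π^m)` is modulo `π` the coefficient of `X^(d q^M)` in `gbar(X^(q^m))`. It vanishes for `m > M`,
since `gbar` has no term of degree below `d`, and it is the leading coefficient of `gbar` for `m =
M`. Evaluation at the points `π^m` is thus triangular on the classes of the `P_M`, which are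
therefore linearly independent in `Int / π Int` (`linearIndependent_of_triangular`).

Two ingredients remain. A suitable `g` comes from `exists_mem_psiKernel_map_ne_zero`: combine `1`
and `X` with coefficients in the image of `phi` so that their traces cancel, after removing the
common power of `π`. The polynomials `c_{g,n}` exist because each coefficient of `[a](X)` is
polynomial in `a` (`coeff_mulSeries_mem_polynomialFunctions`). -/

namespace LubinTate

/-! ### Reduction modulo `π`, and a series in the kernel of `ψ` with nonzero reduction -/

section Reduction

variable {O : Type*} [CommRing O]

theorem map_eq_zero_iff_C_dvd {π : O} {f : PowerSeries O} :
    PowerSeries.map (Ideal.Quotient.mk (Ideal.span {π})) f = 0 ↔ PowerSeries.C π ∣ f := by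
  constructor
  · intro h
    have hc : ∀ n, ∃ c, PowerSeries.coeff n f = π * c := fun n => by
      have := congrArg (PowerSeries.coeff n) h
      rwa [PowerSeries.coeff_map, map_zero, Ideal.Quotient.eq_zero_iff_mem,
        Ideal.mem_span_singleton] at this
    choose c hc using hc
    exact ⟨PowerSeries.mk c, by ext n; rw [PowerSeries.coeff_C_mul, PowerSeries.coeff_mk, hc]⟩
  · rintro ⟨g, rfl⟩
    rw [map_mul, PowerSeries.map_C, Ideal.Quotient.mk_singleton_self, map_zero, zero_mul]

theorem exists_not_C_pow_dvd [IsDomain O] [IsNoetherianRing O] {π : O} (hπ : Irreducible π)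
    {f : PowerSeries O} (hf : f ≠ 0) : ∃ n : ℕ, ¬ PowerSeries.C π ^ n ∣ f := by
  obtain ⟨i, hi⟩ := PowerSeries.exists_coeff_ne_zero_iff_ne_zero.2 hf
  obtain ⟨n, hn⟩ := FiniteMultiplicity.of_not_isUnit hπ.not_isUnit hi
  refine ⟨n + 1, ?_⟩
  rintro ⟨g, rfl⟩
  rw [← map_pow, PowerSeries.coeff_C_mul] at hn
  exact hn (dvd_mul_right _ _)

/-- The largest power of `π` that divides two power series, not both zero, can be removed. -/
theorem exists_eq_C_pow_mul [IsDomain O] [IsNoetherianRing O] {π : O} (hπ : Irreducible π)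
    {f g : PowerSeries O} (h : f ≠ 0 ∨ g ≠ 0) :
    ∃ (n : ℕ) (f' g' : PowerSeries O), f = PowerSeries.C π ^ n * f' ∧ g = PowerSeries.C π ^ n * g' ∧
      (PowerSeries.map (Ideal.Quotient.mk (Ideal.span {π})) f' ≠ 0 ∨
        PowerSeries.map (Ideal.Quotient.mk (Ideal.span {π})) g' ≠ 0) := by
  classical
  have hex : ∃ n : ℕ, ¬ (PowerSeries.C π ^ n ∣ f ∧ PowerSeries.C π ^ n ∣ g) := by
    rcases h with h | h
    · obtain ⟨n, hn⟩ := exists_not_C_pow_dvd hπ h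
      exact ⟨n, fun h => hn h.1⟩
    · obtain ⟨n, hn⟩ := exists_not_C_pow_dvd hπ h
      exact ⟨n, fun h => hn h.2⟩
  -- The exponent `0` always divides, so the least failing exponent is a successor `n + 1`, and `n`
  -- is the power to remove.
  obtain ⟨n, hn⟩ : ∃ n, Nat.find hex = n + 1 := by
    refine Nat.exists_eq_succ_of_ne_zero fun h0 => ?_
    have := Nat.find_spec hex
    rw [h0] at this
    simp at this
  obtain ⟨⟨f', hf⟩, ⟨g', hg⟩⟩ := not_not.1 (Nat.find_min hex (m := n) (by omega))
  refine ⟨n, f', g', hf, hg, ?_⟩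
  by_contra! hcon
  obtain ⟨⟨a, ha⟩, ⟨b, hb⟩⟩ := hcon.imp map_eq_zero_iff_C_dvd.1 map_eq_zero_iff_C_dvd.1
  refine Nat.find_spec hex ?_
  rw [hn]
  exact ⟨⟨a, by rw [hf, ha]; ring⟩, ⟨b, by rw [hg, hb]; ring⟩⟩

theorem map_subst_of_map_eq_X_pow {π : O} {g : PowerSeries O}
    (hg0 : PowerSeries.constantCoeff g = 0) {r : ℕ}
    (hg : PowerSeries.map (Ideal.Quotient.mk (Ideal.span {π})) g = PowerSeries.X ^ r)
    (f : PowerSeries O) :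
    PowerSeries.map (Ideal.Quotient.mk (Ideal.span {π})) (f.subst g) =
      (PowerSeries.map (Ideal.Quotient.mk (Ideal.span {π})) f).subst
        (PowerSeries.X ^ r : PowerSeries (O ⧸ Ideal.span {π})) := by
  rw [← hg]
  exact PowerSeries.map_subst (PowerSeries.HasSubst.of_constantCoeff_zero' hg0) f

theorem map_phi {π : O} (φ : LubinTateSeries π) (f : PowerSeries O) :
    PowerSeries.map (Ideal.Quotient.mk (Ideal.span {π})) (phi φ f) =
      (PowerSeries.map (Ideal.Quotient.mk (Ideal.span {π})) f).subst
        (PowerSeries.X ^ Nat.card (O ⧸ Ideal.span {π}) : PowerSeries (O ⧸ Ideal.span {π})) := by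
  rw [phi, PowerSeries.coe_substAlgHom]
  exact map_subst_of_map_eq_X_pow φ.constantCoeff_eq_zero φ.map_mk_eq f

/-- This semilinearity and additivity are all that is used of the trace; no basis of the extension
is needed. -/
theorem tracePhi_phi_mul {π : O} (φ : LubinTateSeries π) (h f : PowerSeries O) :
    tracePhi φ (phi φ h * f) = phi φ h * tracePhi φ f := by
  have := (Algebra.trace (phi φ).range (PowerSeries O)).map_smul ⟨phi φ h, h, rfl⟩ f
  exact congrArg Subtype.val this

theorem phi_C {π : O} (φ : LubinTateSeries π) (c : O) :
    phi φ (PowerSeries.C c) = PowerSeries.C c := (phi φ).commutes c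

theorem mem_psiKernel {π : O} {φ : LubinTateSeries π} {f : PowerSeries O} :
    f ∈ psiKernel φ ↔ tracePhi φ f = 0 := by
  rw [psiKernel, Set.mem_ofPred_eq, IsPsi, map_zero, mul_zero, eq_comm]

theorem phi_mul_mem_psiKernel {π : O} {φ : LubinTateSeries π} {f : PowerSeries O}
    (hf : f ∈ psiKernel φ) (h : PowerSeries O) : phi φ h * f ∈ psiKernel φ := by
  rw [mem_psiKernel] at hf ⊢
  rw [tracePhi_phi_mul, hf, mul_zero]

/-- With `Tr 1 = phi s` and `Tr X = phi t`, the trace kills `phi t - phi s * X`. Dividing `s` and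
`t` by their common power of `π` keeps this true and makes one of them nonzero modulo `π`. Modulo
`π` the two terms have exponents congruent to `0` and to `1` modulo `q`, with `q > 1`, so they
cannot cancel. -/
theorem exists_mem_psiKernel_map_ne_zero [IsDomain O] [IsNoetherianRing O] {π : O}
    (hπ : Irreducible π) [Nontrivial (O ⧸ Ideal.span {π})] [Finite (O ⧸ Ideal.span {π})]
    (φ : LubinTateSeries π) :
    ∃ f ∈ psiKernel φ, PowerSeries.map (Ideal.Quotient.mk (Ideal.span {π})) f ≠ 0 := by
  by_cases h : tracePhi φ 1 = 0
  · exact ⟨1, mem_psiKernel.2 h, by rw [map_one]; exact one_ne_zero⟩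
  obtain ⟨s, hs⟩ : ∃ s, phi φ s = tracePhi φ 1 := (Algebra.trace (phi φ).range (PowerSeries O) 1).2
  obtain ⟨t, ht⟩ : ∃ t, phi φ t = tracePhi φ PowerSeries.X :=
    (Algebra.trace (phi φ).range (PowerSeries O) PowerSeries.X).2
  have hs0 : s ≠ 0 := by
    rintro rfl
    exact h (by rw [← hs, map_zero])
  obtain ⟨n, s', t', rfl, rfl, hst⟩ := exists_eq_C_pow_mul hπ (f := s) (g := t) (.inl hs0)
  rw [map_mul, map_pow, phi_C] at hs ht
  have hadd : ∀ x y, tracePhi φ (x - y) = tracePhi φ x - tracePhi φ y := fun x y => by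
    simp only [tracePhi, map_sub]; rfl
  have hC : (PowerSeries.C π : PowerSeries O) ^ n ≠ 0 := by
    rw [← map_pow]
    exact (map_ne_zero_iff _ PowerSeries.C_injective).2 (pow_ne_zero _ hπ.ne_zero)
  refine ⟨phi φ t' * 1 - phi φ s' * PowerSeries.X, ?_, ?_⟩
  · rw [mem_psiKernel, hadd, tracePhi_phi_mul, tracePhi_phi_mul]
    refine (mul_eq_zero.1 ?_).resolve_left hC
    rw [← hs, ← ht]
    ring
  · have hq1 : 1 < Nat.card (O ⧸ Ideal.span {π}) := Finite.one_lt_card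
    have hq : Nat.card (O ⧸ Ideal.span {π}) ≠ 0 := by omega
    set q := Nat.card (O ⧸ Ideal.span {π})
    intro h0
    rw [mul_one, map_sub, map_mul, map_phi, map_phi, PowerSeries.map_X] at h0
    -- A nonzero coefficient of index `j` is seen in degree `q * j + 1` if it belongs to `s'`, and
    -- in degree `q * j` if it belongs to `t'`; the other term does not contribute there.
    rcases hst with hst | hst <;> obtain ⟨j, hj⟩ := PowerSeries.exists_coeff_ne_zero_iff_ne_zero.2 hst
    · have := congrArg (PowerSeries.coeff (q * j + 1)) h0
      have hnd : ¬ q ∣ q * j + 1 := by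
        rw [Nat.dvd_add_right (dvd_mul_right _ _), Nat.dvd_one]; omega
      rw [map_sub, PowerSeries.coeff_succ_mul_X, PowerSeries.coeff_subst_X_pow hq,
        PowerSeries.coeff_subst_X_pow hq, if_neg hnd, if_pos (dvd_mul_right _ _),
        Nat.mul_div_cancel_left _ (by omega), zero_sub, map_zero, neg_eq_zero] at this
      exact hj this
    · have := congrArg (PowerSeries.coeff (q * j)) h0
      have hX : PowerSeries.coeff (q * j) ((PowerSeries.map (Ideal.Quotient.mk (Ideal.span {π})) s').subst
          (PowerSeries.X ^ q : PowerSeries (O ⧸ Ideal.span {π})) * PowerSeries.X) = 0 := by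
        rcases Nat.eq_zero_or_pos (q * j) with h | h
        · rw [h, PowerSeries.coeff_zero_mul_X]
        · obtain ⟨m, hm⟩ := Nat.exists_eq_add_of_lt h
          rw [zero_add] at hm
          have hnd : ¬ q ∣ m := fun hd => by
            have : q ∣ m + 1 := hm ▸ dvd_mul_right _ _
            rw [Nat.dvd_add_right hd, Nat.dvd_one] at this
            omega
          rw [hm, PowerSeries.coeff_succ_mul_X, PowerSeries.coeff_subst_X_pow hq, if_neg hnd]
      rw [map_sub, hX, PowerSeries.coeff_subst_X_pow hq, if_pos (dvd_mul_right _ _),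
        Nat.mul_div_cancel_left _ (by omega), sub_zero, map_zero] at this
      exact hj this

end Reduction

/-! ### The series `[π^m](X)` and their reductions -/

section MulSeries

variable {O : Type*} [CommRing O] [IsDomain O] [IsDiscreteValuationRing O]
  [Finite (IsLocalRing.ResidueField O)]

theorem mulSeries_unique {π : O} (hπ : Irreducible π) (φ : LubinTateSeries π) {a : O}
    {g : PowerSeries O} (h0 : PowerSeries.constantCoeff g = 0) (h1 : PowerSeries.coeff 1 g = a)
    (h : φ.toPowerSeries.subst g = g.subst φ.toPowerSeries) : mulSeries hπ φ a = g :=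
  (existsUnique_mulSeries hπ φ a).unique (mulSeries_spec hπ φ a) ⟨h0, h1, h⟩

theorem mulSeries_one {π : O} (hπ : Irreducible π) (φ : LubinTateSeries π) :
    mulSeries hπ φ 1 = PowerSeries.X := by
  refine mulSeries_unique hπ φ PowerSeries.constantCoeff_X PowerSeries.coeff_one_X ?_
  exact (PowerSeries.X_subst _).trans (PowerSeries.subst_X φ.hasSubst).symm

/-- The composite of `[a]` with `[π]` again commutes with `[π]` and has linear coefficient `π * a`,
so uniqueness applies. -/
theorem mulSeries_mul_uniformizer {π : O} (hπ : Irreducible π) (φ : LubinTateSeries π) (a : O) :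
    mulSeries hπ φ (π * a) = (mulSeries hπ φ a).subst φ.toPowerSeries := by
  obtain ⟨h0, h1, h⟩ := mulSeries_spec hπ φ a
  refine mulSeries_unique hπ φ
    (PowerSeries.constantCoeff_subst_eq_zero φ.constantCoeff_eq_zero _ h0) ?_ ?_
  · rw [coeff_subst_of_dvd φ (by rw [pow_one]; exact PowerSeries.X_dvd_iff.2 h0), h1, pow_one]
  · have hs := PowerSeries.HasSubst.of_constantCoeff_zero' h0
    exact (PowerSeries.subst_comp_subst_apply hs φ.hasSubst _).symm.trans
      (congrArg (PowerSeries.subst φ.toPowerSeries) h)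

theorem map_mulSeries_uniformizer_pow {π : O} (hπ : Irreducible π) (φ : LubinTateSeries π) (m : ℕ) :
    PowerSeries.map (Ideal.Quotient.mk (Ideal.span {π})) (mulSeries hπ φ (π ^ m)) =
      PowerSeries.X ^ Nat.card (O ⧸ Ideal.span {π}) ^ m := by
  have : Finite (O ⧸ Ideal.span {π}) := by
    rw [← hπ.maximalIdeal_eq]; exact ‹Finite (IsLocalRing.ResidueField O)›
  induction m with
  | zero => rw [pow_zero, mulSeries_one, PowerSeries.map_X, pow_zero, pow_one]
  | succ m ih =>
    have hs : PowerSeries.HasSubst (PowerSeries.X ^ Nat.card (O ⧸ Ideal.span {π}) :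
      PowerSeries (O ⧸ Ideal.span {π})) := .X_pow Nat.card_pos.ne'
    rw [pow_succ', mulSeries_mul_uniformizer,
      map_subst_of_map_eq_X_pow φ.constantCoeff_eq_zero φ.map_mk_eq, ih]
    rw [PowerSeries.subst_pow hs, PowerSeries.subst_X hs, pow_succ', pow_mul]

end MulSeries

/-! ### Functions `O → O` given by polynomials over `F` -/

section PolynomialFunctions

variable (O : Type*) [CommRing O] (F : Type*) [Field F] [Algebra O F]

/-- The ring of the functions `O → O` given by a polynomial with coefficients in `F`. -/
def polynomialFunctions : Subring (O → O) where
  carrier := {u | ∃ P : Polynomial F, ∀ a, P.eval (algebraMap O F a) = algebraMap O F (u a)}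
  zero_mem' := ⟨0, fun a => by simp⟩
  one_mem' := ⟨1, fun a => by simp⟩
  add_mem' := by
    rintro u v ⟨P, hP⟩ ⟨Q, hQ⟩
    exact ⟨P + Q, fun a => by simp [hP, hQ]⟩
  mul_mem' := by
    rintro u v ⟨P, hP⟩ ⟨Q, hQ⟩
    exact ⟨P * Q, fun a => by simp [hP, hQ]⟩
  neg_mem' := by
    rintro u ⟨P, hP⟩
    exact ⟨-P, fun a => by simp [hP]⟩

variable {O}

theorem const_mem_polynomialFunctions (c : O) : (fun _ => c) ∈ polynomialFunctions O F :=
  ⟨Polynomial.C (algebraMap O F c), fun a => by simp⟩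

theorem id_mem_polynomialFunctions : (fun a => a) ∈ polynomialFunctions O F :=
  ⟨Polynomial.X, fun a => by simp⟩

variable {F}

/-- Division by `c` takes place in `F[T]`; integrality of the values is not at stake, since `u`
already takes its values in `O`. -/
theorem mem_polynomialFunctions_of_mul [FaithfulSMul O F] {c : O} (hc : c ≠ 0) {u : O → O}
    (h : (fun a => c * u a) ∈ polynomialFunctions O F) : u ∈ polynomialFunctions O F := by
  obtain ⟨P, hP⟩ := h
  refine ⟨Polynomial.C (algebraMap O F c)⁻¹ * P, fun a => ?_⟩
  have : algebraMap O F c ≠ 0 :=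
    (map_ne_zero_iff _ (FaithfulSMul.algebraMap_injective O F)).2 hc
  rw [Polynomial.eval_mul, Polynomial.eval_C, hP, map_mul, inv_mul_cancel_left₀ this]

theorem coeff_pow_mem_polynomialFunctions {g : O → PowerSeries O}
    (hg : ∀ n, (fun a => PowerSeries.coeff n (g a)) ∈ polynomialFunctions O F) (d n : ℕ) :
    (fun a => PowerSeries.coeff n (g a ^ d)) ∈ polynomialFunctions O F := by
  induction d generalizing n with
  | zero =>
    simp only [pow_zero]
    exact const_mem_polynomialFunctions F _
  | succ d ih =>
    simp only [pow_succ, PowerSeries.coeff_mul]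
    convert sum_mem (t := Finset.HasAntidiagonal.antidiagonal n) fun (x : ℕ × ℕ) _ => mul_mem (ih x.1) (hg x.2) using 1
    ext a
    simp

theorem coeff_subst_eq_sum {f g : PowerSeries O} (hg : PowerSeries.constantCoeff g = 0) (n : ℕ) :
    PowerSeries.coeff n (f.subst g) =
      ∑ d ∈ Finset.range (n + 1), PowerSeries.coeff d f * PowerSeries.coeff n (g ^ d) := by
  rw [PowerSeries.coeff_subst' (PowerSeries.HasSubst.of_constantCoeff_zero' hg)]
  refine finsum_eq_sum_of_support_subset _ fun d hd => ?_
  rw [Finset.coe_range, Set.mem_Iio]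
  by_contra! hlt
  refine hd ?_
  have : PowerSeries.X ^ d ∣ g ^ d := pow_dvd_pow_of_dvd (PowerSeries.X_dvd_iff.2 hg) d
  simp only [PowerSeries.X_pow_dvd_iff.1 this n (by omega), smul_zero]

theorem coeff_subst_mem_polynomialFunctions {f g : O → PowerSeries O}
    (hf : ∀ n, (fun a => PowerSeries.coeff n (f a)) ∈ polynomialFunctions O F)
    (hg : ∀ n, (fun a => PowerSeries.coeff n (g a)) ∈ polynomialFunctions O F)
    (hg0 : ∀ a, PowerSeries.constantCoeff (g a) = 0) (n : ℕ) :
    (fun a => PowerSeries.coeff n ((f a).subst (g a))) ∈ polynomialFunctions O F := by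
  simp only [coeff_subst_eq_sum (hg0 _)]
  convert sum_mem (t := Finset.range (n + 1)) fun d _ =>
    mul_mem (hf d) (coeff_pow_mem_polynomialFunctions hg d n) using 1
  ext a
  simp

end PolynomialFunctions

/-! ### Existence of the polynomials `c_{f,n}` -/

section DVR

variable {O : Type*} [CommRing O] [IsDomain O] [IsDiscreteValuationRing O]
  [Finite (IsLocalRing.ResidueField O)] {F : Type*} [Field F] [Algebra O F] [FaithfulSMul O F]

/-- Comparing the degree `n` terms in `[π]([a](X)) = [a]([π](X))` expresses `π - π ^ n` times the
`n`-th coefficient of `[a]` through the lower coefficients. Strong induction then applies, because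
`π - π ^ n` is nonzero for `n ≥ 2`. -/
theorem coeff_mulSeries_mem_polynomialFunctions {π : O} (hπ : Irreducible π) (φ : LubinTateSeries π)
    (n : ℕ) :
    (fun a => PowerSeries.coeff n (mulSeries hπ φ a)) ∈ polynomialFunctions O F := by
  induction n using Nat.strong_induction_on with
  | _ n ih =>
    rcases Nat.lt_or_ge n 2 with hn | hn
    · interval_cases n
      · convert zero_mem (polynomialFunctions O F) with a
        rw [PowerSeries.coeff_zero_eq_constantCoeff_apply, (mulSeries_spec hπ φ a).1]
        rfl
      · simp only [(mulSeries_spec hπ φ _).2.1]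
        exact id_mem_polynomialFunctions F
    -- `T a` keeps only the terms of `[a]` of degree below `n`, which the induction hypothesis
    -- controls.
    · let T : O → PowerSeries O := fun a => (PowerSeries.trunc n (mulSeries hπ φ a) : Polynomial O)
      have hTc : ∀ a i, PowerSeries.coeff i (T a) =
          if i < n then PowerSeries.coeff i (mulSeries hπ φ a) else 0 := fun a i => by
        rw [Polynomial.coeff_coe, PowerSeries.coeff_trunc]
      have hT0 : ∀ a, PowerSeries.constantCoeff (T a) = 0 := fun a => by
        rw [← PowerSeries.coeff_zero_eq_constantCoeff_apply, hTc, if_pos (by omega),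
          PowerSeries.coeff_zero_eq_constantCoeff_apply, (mulSeries_spec hπ φ a).1]
      have hT : ∀ i, (fun a => PowerSeries.coeff i (T a)) ∈ polynomialFunctions O F := fun i => by
        simp only [hTc]
        split_ifs with hi
        · exact ih i hi
        · exact zero_mem _
      have hc : π - π ^ n ≠ 0 := by
        intro h
        have h1 : π * (1 - π ^ (n - 1)) = 0 := by
          rw [mul_sub, mul_one, ← pow_succ', Nat.sub_add_cancel (by omega), h]
        have h2 := (mul_eq_zero.1 h1).resolve_left hπ.ne_zero
        refine hπ.not_isUnit ((isUnit_pow_iff (n := n - 1) (by omega)).1 ?_)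
        rw [← sub_eq_zero.1 h2]
        exact isUnit_one
      refine mem_polynomialFunctions_of_mul hc ?_
      have hφ : ∀ i, (fun _ : O => PowerSeries.coeff i φ.toPowerSeries) ∈ polynomialFunctions O F :=
        fun i => const_mem_polynomialFunctions F _
      convert sub_mem
        (coeff_subst_mem_polynomialFunctions hT hφ (fun _ => φ.constantCoeff_eq_zero) n)
        (coeff_subst_mem_polynomialFunctions hφ hT hT0 n) using 1
      ext a
      obtain ⟨h0, h1, h⟩ := mulSeries_spec hπ φ a
      have hX : PowerSeries.X ^ n ∣ mulSeries hπ φ a - T a := by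
        rw [PowerSeries.X_pow_dvd_iff]
        intro i hi
        rw [map_sub, hTc, if_pos hi, sub_self]
      -- The commutation defect of `[a]` is zero and `T a` has no term of degree `n`, so the defect
      -- of `T a` in degree `n` is, up to sign, `π - π ^ n` times the coefficient sought.
      have := coeff_defect_sub φ (hT0 a) h0 hX
      rw [h, sub_self, map_zero, zero_sub, hTc a n, if_neg (lt_irrefl n), sub_zero, map_sub,
        neg_sub] at this
      exact this.symm

theorem exists_isCoeffPolynomial {π : O} (hπ : Irreducible π) (φ : LubinTateSeries π)
    (f : PowerSeries O) (n : ℕ) :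
    ∃ P : integerValued O F, IsCoeffPolynomial F hπ φ f n (P : Polynomial F) := by
  obtain ⟨P, hP⟩ := coeff_subst_mem_polynomialFunctions (F := F)
    (fun i => const_mem_polynomialFunctions F (PowerSeries.coeff i f))
    (coeff_mulSeries_mem_polynomialFunctions hπ φ) (fun a => (mulSeries_spec hπ φ a).1) n
  exact ⟨⟨P, fun a => ⟨_, (hP a).symm⟩⟩, hP⟩

end DVR

/-! ### Evaluation on `Int / π Int`, and linear independence -/

section Evaluation

variable {O : Type*} [CommRing O] {F : Type*} [Field F] [Algebra O F] [FaithfulSMul O F]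

/-- The value in `O` of an integer-valued polynomial at a point of `O`. -/
noncomputable def evalInt (a : O) : integerValued O F →ₗ[O] O where
  toFun P := (P.2 a).choose
  map_add' P Q := FaithfulSMul.algebraMap_injective O F (by
    rw [map_add, ((P + Q).2 a).choose_spec, (P.2 a).choose_spec, (Q.2 a).choose_spec,
      Submodule.coe_add, Polynomial.eval_add])
  map_smul' c P := FaithfulSMul.algebraMap_injective O F (by
    rw [RingHom.id_apply, smul_eq_mul, map_mul, ((c • P).2 a).choose_spec, (P.2 a).choose_spec,
      Submodule.coe_smul, Polynomial.eval_smul, Algebra.smul_def])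

theorem algebraMap_evalInt (a : O) (P : integerValued O F) :
    algebraMap O F (evalInt a P) = (P : Polynomial F).eval (algebraMap O F a) :=
  (P.2 a).choose_spec

/-- Evaluation at a point of `O`, as a linear form on `Int / π Int`. -/
noncomputable def evalModPi (π a : O) : IntModPi F π →ₗ[O ⧸ Ideal.span {π}] O ⧸ Ideal.span {π} :=
  LinearMap.extendScalarsOfSurjective Ideal.Quotient.mk_surjective
    (Submodule.liftQ _ ((Algebra.linearMap O (O ⧸ Ideal.span {π})).comp (evalInt a)) (by
      rw [Submodule.smul_le]
      intro r hr P _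
      rw [LinearMap.mem_ker, map_smul, Algebra.smul_def]
      exact mul_eq_zero_of_left (Ideal.Quotient.eq_zero_iff_mem.2 hr) _))

theorem evalModPi_mk (π a : O) (P : integerValued O F) :
    evalModPi π a (Submodule.Quotient.mk P) = Ideal.Quotient.mk (Ideal.span {π}) (evalInt a P) :=
  rfl

end Evaluation

/-- In a linear relation, the functional attached to the largest index of the support sees only the
term of that index. -/
theorem linearIndependent_of_triangular {K V : Type*} [Ring K] [IsDomain K] [AddCommGroup V] [Module K V]
    (v : ℕ → V) (ev : ℕ → V →ₗ[K] K) (h0 : ∀ m n, n < m → ev m (v n) = 0)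
    (h1 : ∀ n, ev n (v n) ≠ 0) : LinearIndependent K v := by
  rw [linearIndependent_iff]
  intro c hc
  by_contra hne
  have hs := Finsupp.support_nonempty_iff.2 hne
  set m := c.support.max' hs
  have := congrArg (ev m) hc
  rw [Finsupp.linearCombination_apply, Finsupp.sum, map_sum, map_zero,
    Finset.sum_eq_single_of_mem m (c.support.max'_mem hs), map_smul, smul_eq_mul] at this
  · exact (mul_ne_zero (Finsupp.mem_support_iff.1 (c.support.max'_mem hs)) (h1 m)) this
  · intro n hn hnm
    rw [map_smul, h0 m n (lt_of_le_of_ne (c.support.le_max' n hn) hnm), smul_zero]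

theorem not_finite_imageModPi_Pol_psiKernel {O : Type*} [CommRing O] [IsDomain O]
    [IsDiscreteValuationRing O] [Finite (IsLocalRing.ResidueField O)] (F : Type*) [Field F]
    [Algebra O F] [FaithfulSMul O F] {π : O} (hπ : Irreducible π) (φ : LubinTateSeries π) :
    ¬ Module.Finite (O ⧸ Ideal.span {π}) (imageModPi F π (Pol F hπ φ (psiKernel φ))) := by
  have hmax : (Ideal.span {π}).IsMaximal :=
    hπ.maximalIdeal_eq ▸ IsLocalRing.maximalIdeal.isMaximal O
  have : Finite (O ⧸ Ideal.span {π}) := by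
    rw [← hπ.maximalIdeal_eq]; exact ‹Finite (IsLocalRing.ResidueField O)›
  have : IsDomain (O ⧸ Ideal.span {π}) := Ideal.Quotient.isDomain _
  have hq1 : 1 < Nat.card (O ⧸ Ideal.span {π}) := Finite.one_lt_card
  obtain ⟨f, hf, hf0⟩ := exists_mem_psiKernel_map_ne_zero hπ φ
  -- The factor `phi X` preserves the kernel of `ψ` and forces the reduction to have order `d > 0`.
  -- With `d = 0` the indices `d * q ^ M` would all coincide.
  set g : PowerSeries O := phi φ PowerSeries.X * f with hg
  set gbar := PowerSeries.map (Ideal.Quotient.mk (Ideal.span {π})) g with hgbar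
  set q := Nat.card (O ⧸ Ideal.span {π})
  have hq : q ≠ 0 := by omega
  have hgX : gbar = PowerSeries.X ^ q * PowerSeries.map (Ideal.Quotient.mk (Ideal.span {π})) f := by
    rw [hgbar, hg, map_mul, map_phi, PowerSeries.map_X, PowerSeries.subst_X (.X_pow hq)]
  have hex : ∃ d, PowerSeries.coeff d gbar ≠ 0 := by
    rw [PowerSeries.exists_coeff_ne_zero_iff_ne_zero, hgX]
    exact mul_ne_zero (pow_ne_zero _ PowerSeries.X_ne_zero) hf0
  classical
  obtain ⟨d, hd, hmin⟩ : ∃ d, PowerSeries.coeff d gbar ≠ 0 ∧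
      ∀ i < d, PowerSeries.coeff i gbar = 0 :=
    ⟨Nat.find hex, Nat.find_spec hex, fun i hi => not_not.1 (Nat.find_min hex hi)⟩
  have hd0 : 0 < d := by
    rcases Nat.eq_zero_or_pos d with rfl | h
    · refine absurd ?_ hd
      exact PowerSeries.X_pow_dvd_iff.1 (hgX ▸ dvd_mul_right _ _) 0 (by omega)
    · exact h
  choose P hP using fun M : ℕ => exists_isCoeffPolynomial (F := F) hπ φ g (d * q ^ M)
  -- Modulo `π`, substituting `[π^m]` into `g` gives `gbar(X^(q^m))`, whose coefficients sit in
  -- degrees divisible by `q ^ m`.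
  have hev : ∀ m M, Ideal.Quotient.mk (Ideal.span {π}) (evalInt (π ^ m) (P M)) =
      if q ^ m ∣ d * q ^ M then PowerSeries.coeff (d * q ^ M / q ^ m) gbar else 0 := by
    intro m M
    have h1 : evalInt (π ^ m) (P M) =
        PowerSeries.coeff (d * q ^ M) (g.subst (mulSeries hπ φ (π ^ m))) :=
      FaithfulSMul.algebraMap_injective O F ((algebraMap_evalInt _ _).trans (hP M _))
    rw [h1, ← PowerSeries.coeff_map, map_subst_of_map_eq_X_pow (mulSeries_spec hπ φ _).1
      (map_mulSeries_uniformizer_pow hπ φ m), PowerSeries.coeff_subst_X_pow (pow_ne_zero _ hq)]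
    rfl
  let v : ℕ → imageModPi F π (Pol F hπ φ (psiKernel φ)) := fun M =>
    ⟨Submodule.Quotient.mk (P M), P M,
      Submodule.subset_span ⟨g, phi_mul_mem_psiKernel hf _, _, hP M⟩, rfl⟩
  have hv : LinearIndependent (O ⧸ Ideal.span {π}) v := by
    refine linearIndependent_of_triangular v
      (fun m => (evalModPi π (π ^ m)).comp (Submodule.subtype _)) (fun m M hlt => ?_) (fun M => ?_)
    · refine (hev m M).trans ?_
      split_ifs with hdvd
      -- For `M < m` the quotient `d * q ^ M / q ^ m` is less than `d`, the order of `gbar`.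
      · refine hmin _ (Nat.div_lt_of_lt_mul ?_)
        rw [mul_comm]
        exact Nat.mul_lt_mul_of_pos_right (Nat.pow_lt_pow_right hq1 hlt) hd0
      · rfl
    · refine fun h => hd ?_
      have := (hev M M).symm.trans h
      rwa [if_pos (dvd_mul_left _ _), Nat.mul_div_cancel _ (by positivity)] at this
  intro hfin
  exact Module.Finite.not_linearIndependent_of_infinite v hv

end LubinTate

theorem mainTheorem5 (p : ℕ) [Fact p.Prime] (F : Type*) [Field F] [Algebra ℚ_[p] F]
    [FiniteDimensional ℚ_[p] F] [Algebra ℤ_[p] F] [IsScalarTower ℤ_[p] ℚ_[p] F]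
    (π : integralClosure ℤ_[p] F) (hπ : Irreducible π) (φ : LubinTate.LubinTateSeries π) :
    ¬ Module.Finite (integralClosure ℤ_[p] F ⧸ Ideal.span {π})
      (LubinTate.imageModPi F π
        (LubinTate.Pol F hπ φ (LubinTate.psiKernel φ))) :=
  LubinTate.not_finite_imageModPi_Pol_psiKernel F hπ φ
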